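/- Let $q$ be a prime power, let $1\le d\le q$, and let $F\in\mathbb{F}_{q^2}[x_0,x_1,x_2,x_3]$ be a nonzero homogeneous polynomial of degree $d$, with zero set $V(F)\subset\mathbb{P}^3$. Let $P\mathcal{U}_2\subset\mathbb{P}^3$ be a degenerate Hermitian surface of rank $3$, that is, the zero set of $x^{T}Hx^{(q)}=\sum_{i,j}h_{ij}x_ix_j^q$, where $H=(h_{ij})$ is a $4\times4$ matrix of rank $3$ over $\mathbb{F}_{q^2}$ with $h_{ij}=h_{ji}^q$ for all $i,j$ (a cone over a non-degenerate Hermitian curve $\mathcal{U}_2$ with vertex an $\mathbb{F}_{q^2}$-rational point $P$). Then $$|P\mathcal{U}_2(\mathbb{F}_{q^2})\cap V(F)(\mathbb{F}_{q^2})|=1+q^2d(q+1)$$ if and only if the set $P\mathcal{U}_2(\mathbb{F}_{q^2})\cap V(F)(\mathbb{F}_{q^2})$ is the union of the sets of $\mathbb{F}_{q^2}$-rational points of $d(q+1)$ distinct lines, each defined over $\mathbb{F}_{q^2}$ and contained in $P\mathcal{U}_2$. -/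

import Mathlib

namespace HermitianCone

/-- The `L`-rational points, in `n`-dimensional projective space, of the projective variety `V(F)`
of a homogeneous polynomial `F` over `K`, where `L` is an extension field of `K`. -/
def zeroLocus {K : Type*} [Field K] {n : ℕ} (F : MvPolynomial (Fin (n + 1)) K)
    (L : Type*) [Field L] [Algebra K L] : Set (Projectivization L (Fin (n + 1) → L)) :=
  {p | MvPolynomial.aeval p.rep F = 0}

/-- For homogeneous `F`, membership in `V(F)` does not depend on the representing vector. -/
theorem mk_mem_zeroLocus_iff {K : Type*} [Field K] {n d : ℕ} {F : MvPolynomial (Fin (n + 1)) K}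
    (hF : F.IsHomogeneous d) (L : Type*) [Field L] [Algebra K L]
    (v : Fin (n + 1) → L) (hv : v ≠ 0) :
    Projectivization.mk L v hv ∈ zeroLocus F L ↔ MvPolynomial.aeval v F = 0 := by
  obtain ⟨a, ha⟩ := Projectivization.exists_smul_eq_mk_rep L v hv
  have key : MvPolynomial.aeval (Projectivization.mk L v hv).rep F
      = (a : L) ^ d * MvPolynomial.aeval v F := by
    rw [← ha, MvPolynomial.aeval_def, MvPolynomial.aeval_def, MvPolynomial.eval₂_eq,
      MvPolynomial.eval₂_eq, Finset.mul_sum]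
    refine Finset.sum_congr rfl fun m hm => ?_
    have hdeg : ∑ i ∈ m.support, m i = d :=
      (hF.degree_eq_sum_deg_support hm).symm
    simp only [Units.smul_def, Pi.smul_apply, smul_eq_mul, mul_pow, Finset.prod_mul_distrib,
      Finset.prod_pow_eq_pow_sum, hdeg]
    ring
  simp [zeroLocus, key]

/-- The `L`-rational points of the projective linear subspace, defined over `K`, that is given by
the linear subspace `W` of `K ^ (n + 1)`. -/
def linearPoints {K : Type*} [Field K] {n : ℕ} (W : Submodule K (Fin (n + 1) → K))
    (L : Type*) [Field L] [Algebra K L] : Set (Projectivization L (Fin (n + 1) → L)) :=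
  {p | p.rep ∈ Submodule.span L
    ((fun (w : Fin (n + 1) → K) (i : Fin (n + 1)) => algebraMap K L (w i)) '' (W : Set _))}

theorem mem_linearPoints_self_iff {K : Type*} [Field K] {n : ℕ}
    (W : Submodule K (Fin (n + 1) → K)) (p : Projectivization K (Fin (n + 1) → K)) :
    p ∈ linearPoints W K ↔ p.rep ∈ W := by
  simp [linearPoints]

/-- A `K`-line of projective `n`-space contained in the variety `V(F)`. The line is given by a
two-dimensional subspace of `K ^ (n + 1)`, and containment is containment of varieties, that is, of
points over an algebraic closure of `K`. -/
def IsLineOf {K : Type*} [Field K] {n : ℕ} (F : MvPolynomial (Fin (n + 1)) K)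
    (W : Submodule K (Fin (n + 1) → K)) : Prop :=
  Module.finrank K W = 2 ∧
    linearPoints W (AlgebraicClosure K) ⊆ zeroLocus F (AlgebraicClosure K)

/-- A Hermitian matrix over the field with `q ^ 2` elements: `H ≠ 0` and `Hᵀ = H^(q)`. -/
def IsHermitianMatrix {K : Type*} [Field K] {n : ℕ} (q : ℕ)
    (H : Matrix (Fin (n + 1)) (Fin (n + 1)) K) : Prop :=
  H ≠ 0 ∧ H.transpose = H.map (fun a => a ^ q)

/-- The polynomial `xᵀ H x^(q)`, whose zero set is the Hermitian variety of `H`. -/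
noncomputable def hermitianPoly {K : Type*} [Field K] {n : ℕ} (q : ℕ)
    (H : Matrix (Fin (n + 1)) (Fin (n + 1)) K) : MvPolynomial (Fin (n + 1)) K :=
  ∑ i, ∑ j, MvPolynomial.C (H i j) * MvPolynomial.X i * MvPolynomial.X j ^ q

end HermitianCone


/-!
In suitable coordinates, with the vertex at `(1, 0, 0, 0)`, the cone stands over the plane curve
`y + y ^ q + β x ^ (q + 1) + γ = 0` with `β ≠ 0`. Give `x` and `y` their pole orders at the point at
infinity, `q` and `q + 1`. If a plane curve `V(G)` of degree `e ≤ q` has leading monomial of weight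
`w`, then the monomials with weight in the Apéry set of `⟨q, q + 1⟩` with respect to `w` span the
functions on the affine common points, and that set has at most `w` elements; hence `V(G)` meets the
Hermitian curve in at most `e (q + 1)` points.

Let `k` be the degree of `F` in the vertex coordinate and `G` its leading coefficient, a form of
degree `d - k` in the other three. A generator of the cone over a point off `V(G)` carries at most
`k` points of `V(F)` besides the vertex, and at most `(d - k) (q + 1)` generators lie over `V(G)`.
Counting, `1 + q ^ 2 d (q + 1)` points force `k = 0`, so that `V(F)` is a cone with the same vertex
and the intersection a union of generators. Conversely, a line on the Hermitian cone is a totally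
isotropic plane of the Hermitian form, and such a plane contains the radical, so every line on the
cone passes through the vertex; lines through a common point are counted directly.
-/

namespace HermitianCone

open Submodule

/-- The Apéry set of a numerical semigroup `S` with respect to `w`: the elements `n` of `S` such
that `n - w` is not in `S`. -/
def aperySet (S : AddSubmonoid ℕ) (w : ℕ) : Set ℕ :=
  {n | n ∈ S ∧ ∀ m ∈ S, w + m ≠ n}

theorem injOn_mod_aperySet {S : AddSubmonoid ℕ} {w : ℕ} (hw : w ∈ S) :
    Set.InjOn (· % w) (aperySet S w) := by
  suffices key : ∀ m ∈ aperySet S w, ∀ n ∈ aperySet S w, m ≤ n → m % w = n % w → m = n by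
    intro m hm n hn h
    exact (le_total m n).elim (key m hm n hn · h) fun hle => (key n hn m hm hle h.symm).symm
  intro m hm n hn hle h
  obtain ⟨k, hk⟩ := (Nat.modEq_iff_dvd' hle).1 h
  cases k with
  | zero => omega
  | succ k =>
    refine absurd ?_ (hn.2 (m + k * w) (S.add_mem hm.1 (by simpa using S.nsmul_mem hw k)))
    have : w * (k + 1) = k * w + w := by ring
    omega

theorem mapsTo_mod_aperySet (S : AddSubmonoid ℕ) (w : ℕ) :
    Set.MapsTo (· % w) (aperySet S w) (Set.Iio w) := by
  intro n hn
  rcases w.eq_zero_or_pos with rfl | hw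
  · exact absurd (zero_add n) (hn.2 n hn.1)
  · exact Nat.mod_lt n hw

theorem finite_aperySet {S : AddSubmonoid ℕ} {w : ℕ} (hw : w ∈ S) : (aperySet S w).Finite :=
  Set.Finite.of_injOn (mapsTo_mod_aperySet S w) (injOn_mod_aperySet hw) (Set.finite_Iio w)

theorem ncard_aperySet_le {S : AddSubmonoid ℕ} {w : ℕ} (hw : w ∈ S) :
    (aperySet S w).ncard ≤ w := by
  simpa using Set.ncard_le_ncard_of_injOn _ (mapsTo_mod_aperySet S w) (injOn_mod_aperySet hw)
    (Set.finite_Iio w)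

theorem mem_closure_pair_iff_exists_mul {a b n : ℕ} :
    n ∈ AddSubmonoid.closure {a, b} ↔ ∃ i j, a * i + b * j = n := by
  simp only [AddSubmonoid.mem_closure_pair, smul_eq_mul, mul_comm]

theorem exists_eq_add_mul_of_coprime {a b i j i' j' : ℕ} (hab : a.Coprime b) (hb : b ≠ 0)
    (hle : i ≤ i') (h : a * i + b * j = a * i' + b * j') :
    ∃ k, i' = i + b * k ∧ j = j' + a * k := by
  obtain ⟨l, rfl⟩ := Nat.exists_eq_add_of_le hle
  have h' : b * j = b * j' + a * l := by linarith
  obtain ⟨k, rfl⟩ : b ∣ l := by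
    refine hab.symm.dvd_of_dvd_mul_left ((Nat.dvd_add_right (dvd_mul_right b j')).1 ?_)
    exact h' ▸ dvd_mul_right b j
  exact ⟨k, rfl, Nat.eq_of_mul_eq_mul_left (Nat.pos_of_ne_zero hb) (by rw [h']; ring)⟩

/-- The part of weight less than `n` of the subalgebra generated by `x`, of weight `a`, and `y`, of
weight `b`: the span of the monomials `x ^ i * y ^ j` with `a * i + b * j < n`. -/
def weightLT (K : Type*) {A : Type*} [Field K] [CommRing A] [Algebra K A] (a b : ℕ) (x y : A)
    (n : ℕ) : Submodule K A :=
  span K {z | ∃ i j, a * i + b * j < n ∧ x ^ i * y ^ j = z}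

section Weight

variable {K A : Type*} [Field K] [CommRing A] [Algebra K A] {a b : ℕ} {x y : A}

theorem monomial_mem_weightLT {i j n : ℕ} (h : a * i + b * j < n) :
    x ^ i * y ^ j ∈ weightLT K a b x y n :=
  subset_span ⟨i, j, h, rfl⟩

theorem weightLT_le_iff {n : ℕ} {W : Submodule K A} :
    weightLT K a b x y n ≤ W ↔ ∀ i j, a * i + b * j < n → x ^ i * y ^ j ∈ W := by
  refine span_le.trans ⟨fun h i j hij => h ⟨i, j, hij, rfl⟩, ?_⟩
  rintro h _ ⟨i, j, hij, rfl⟩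
  exact h i j hij

theorem monomial_mul_mem_weightLT {n m i j : ℕ} (hm : a * i + b * j + n = m) {z : A}
    (hz : z ∈ weightLT K a b x y n) : x ^ i * y ^ j * z ∈ weightLT K a b x y m := by
  suffices h : weightLT K a b x y n ≤
      (weightLT K a b x y m).comap (LinearMap.mulLeft K (x ^ i * y ^ j)) from h hz
  refine weightLT_le_iff.2 fun i' j' h => ?_
  have hmul : x ^ i * y ^ j * (x ^ i' * y ^ j') = x ^ (i + i') * y ^ (j + j') := by ring
  rw [mem_comap, LinearMap.mulLeft_apply, hmul]
  exact monomial_mem_weightLT (by linarith)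

variable {c : K} (hc : c ≠ 0) (hxy : y ^ a - c • x ^ b ∈ weightLT K a b x y (a * b))

include hxy in
theorem pow_mul_sub_smul_pow_mul_mem_weightLT (k : ℕ) :
    y ^ (a * k) - c ^ k • x ^ (b * k) ∈ weightLT K a b x y (a * b * k) := by
  induction k with
  | zero => simp
  | succ k ih =>
    have hsplit : y ^ (a * (k + 1)) - c ^ (k + 1) • x ^ (b * (k + 1)) =
        x ^ 0 * y ^ (a * k) * (y ^ a - c • x ^ b) +
          c • (x ^ b * y ^ 0 * (y ^ (a * k) - c ^ k • x ^ (b * k))) := by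
      simp only [Algebra.smul_def, map_pow]
      ring
    rw [hsplit]
    exact add_mem (monomial_mul_mem_weightLT (by ring) hxy)
      (smul_mem _ _ (monomial_mul_mem_weightLT (by ring) ih))

include hxy in
theorem monomial_sub_smul_monomial_mem_weightLT (i j k : ℕ) :
    x ^ i * y ^ (j + a * k) - c ^ k • (x ^ (i + b * k) * y ^ j) ∈
      weightLT K a b x y (a * i + b * (j + a * k)) := by
  have hfactor : x ^ i * y ^ (j + a * k) - c ^ k • (x ^ (i + b * k) * y ^ j) =
      x ^ i * y ^ j * (y ^ (a * k) - c ^ k • x ^ (b * k)) := by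
    simp only [Algebra.smul_def]
    ring
  rw [hfactor]
  exact monomial_mul_mem_weightLT (by ring) (pow_mul_sub_smul_pow_mul_mem_weightLT hxy k)

include hc hxy in
theorem exists_sub_smul_mem_weightLT (hab : a.Coprime b) (hb : b ≠ 0) {i j i' j' : ℕ}
    (h : a * i + b * j = a * i' + b * j') :
    ∃ u : K, x ^ i * y ^ j - u • (x ^ i' * y ^ j') ∈ weightLT K a b x y (a * i + b * j) := by
  rcases le_total i i' with hle | hle
  · obtain ⟨k, rfl, rfl⟩ := exists_eq_add_mul_of_coprime hab hb hle h
    exact ⟨c ^ k, monomial_sub_smul_monomial_mem_weightLT hxy i j' k⟩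
  · obtain ⟨k, rfl, rfl⟩ := exists_eq_add_mul_of_coprime hab hb hle h.symm
    have hck : c ^ k ≠ 0 := pow_ne_zero k hc
    refine ⟨(c ^ k)⁻¹, ?_⟩
    rw [h, ← neg_mem_iff, neg_sub, ← smul_mem_iff _ hck, smul_sub, smul_inv_smul₀ hck]
    exact monomial_sub_smul_monomial_mem_weightLT hxy i' j k

-- Modulo lower weights, monomials of equal weight are proportional, and every weight outside the
-- Apéry set is that of a multiple of the leading monomial `x ^ i₀ * y ^ j₀`.
include hc hxy in
theorem monomial_mem_span_image_aperySet (hab : a.Coprime b) (hb : b ≠ 0) {i₀ j₀ : ℕ}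
    (hlead : x ^ i₀ * y ^ j₀ ∈ weightLT K a b x y (a * i₀ + b * j₀)) {e : ℕ → A}
    (he : ∀ n ∈ AddSubmonoid.closure {a, b}, ∃ i j, a * i + b * j = n ∧ x ^ i * y ^ j = e n)
    (i j : ℕ) :
    x ^ i * y ^ j ∈
      span K (e '' aperySet (AddSubmonoid.closure {a, b}) (a * i₀ + b * j₀)) := by
  set T := aperySet (AddSubmonoid.closure {a, b}) (a * i₀ + b * j₀)
  induction hn : a * i + b * j using Nat.strong_induction_on generalizing i j with
  | _ n ih =>
    have hlower : weightLT K a b x y n ≤ span K (e '' T) :=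
      weightLT_le_iff.2 fun i j hij => ih _ hij i j rfl
    have hnS : n ∈ AddSubmonoid.closure {a, b} := mem_closure_pair_iff_exists_mul.2 ⟨i, j, hn⟩
    suffices h : ∃ i' j', a * i' + b * j' = n ∧ x ^ i' * y ^ j' ∈ span K (e '' T) by
      obtain ⟨i', j', hn', hmem⟩ := h
      obtain ⟨u, hu⟩ := exists_sub_smul_mem_weightLT hc hxy hab hb (hn.trans hn'.symm)
      exact (sub_mem_iff_left _ (smul_mem _ u hmem)).1 (hlower (hn ▸ hu))
    by_cases hnT : n ∈ T
    · obtain ⟨i', j', hn', he'⟩ := he n hnS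
      exact ⟨i', j', hn', he' ▸ subset_span ⟨n, hnT, rfl⟩⟩
    · obtain ⟨m, hm, hmn⟩ : ∃ m ∈ AddSubmonoid.closure {a, b}, a * i₀ + b * j₀ + m = n := by
        by_contra! h
        exact hnT ⟨hnS, h⟩
      obtain ⟨i', j', rfl, -⟩ := he m hm
      refine ⟨i' + i₀, j' + j₀, by linarith, hlower ?_⟩
      have hmul : x ^ (i' + i₀) * y ^ (j' + j₀) = x ^ i' * y ^ j' * (x ^ i₀ * y ^ j₀) := by ring
      rw [hmul]
      exact monomial_mul_mem_weightLT (by linarith) hlead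

include hc hxy in
theorem finrank_le_weight (hab : a.Coprime b) (hb : b ≠ 0) {i₀ j₀ : ℕ}
    (hlead : x ^ i₀ * y ^ j₀ ∈ weightLT K a b x y (a * i₀ + b * j₀))
    (hspan : span K (Set.range fun m : ℕ × ℕ => x ^ m.1 * y ^ m.2) = ⊤) :
    Module.finrank K A ≤ a * i₀ + b * j₀ := by
  have hweights : ∀ n : ℕ, ∃ z : A, n ∈ AddSubmonoid.closure {a, b} →
      ∃ i j, a * i + b * j = n ∧ x ^ i * y ^ j = z := by
    intro n
    by_cases hn : n ∈ AddSubmonoid.closure {a, b}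
    · obtain ⟨i, j, hij⟩ := mem_closure_pair_iff_exists_mul.1 hn
      exact ⟨x ^ i * y ^ j, fun _ => ⟨i, j, hij, rfl⟩⟩
    · exact ⟨0, fun h => absurd h hn⟩
  choose e he using hweights
  set T := aperySet (AddSubmonoid.closure {a, b}) (a * i₀ + b * j₀)
  have hw : a * i₀ + b * j₀ ∈ AddSubmonoid.closure {a, b} :=
    mem_closure_pair_iff_exists_mul.2 ⟨i₀, j₀, rfl⟩
  have hTfin : (e '' T).Finite := (finite_aperySet hw).image e
  have hTspan : span K (e '' T) = ⊤ := by
    rw [eq_top_iff, ← hspan, span_le]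
    rintro _ ⟨m, rfl⟩
    exact monomial_mem_span_image_aperySet hc hxy hab hb hlead he m.1 m.2
  have := hTfin.fintype
  calc Module.finrank K A = Module.finrank K (span K (e '' T)) := by rw [hTspan, finrank_top]
    _ ≤ (e '' T).ncard := by
      rw [Set.ncard_eq_toFinset_card']
      exact finrank_span_le_card _
    _ ≤ T.ncard := Set.ncard_image_le (finite_aperySet hw)
    _ ≤ a * i₀ + b * j₀ := ncard_aperySet_le hw

end Weight

section HomogeneousForms

variable {K : Type*} [Field K] {n d : ℕ} {F : MvPolynomial (Fin (n + 1)) K}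

theorem sum_eq_of_mem_support (hF : F.IsHomogeneous d) {m : Fin (n + 1) →₀ ℕ}
    (hm : m ∈ F.support) : ∑ i, m i = d := by
  simpa [Finsupp.weight_apply, Finsupp.sum_fintype] using hF (MvPolynomial.mem_support_iff.1 hm)

theorem eval_smul_of_isHomogeneous (hF : F.IsHomogeneous d) (c : K) (v : Fin (n + 1) → K) :
    MvPolynomial.eval (c • v) F = c ^ d * MvPolynomial.eval v F := by
  rw [MvPolynomial.eval_eq', MvPolynomial.eval_eq', Finset.mul_sum]
  refine Finset.sum_congr rfl fun m hm => ?_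
  simp only [Pi.smul_apply, smul_eq_mul, mul_pow, Finset.prod_mul_distrib,
    Finset.prod_pow_eq_pow_sum, sum_eq_of_mem_support hF hm]
  ring

theorem eval_single_eq_coeff (hF : F.IsHomogeneous d) (i : Fin (n + 1)) :
    MvPolynomial.eval (Pi.single i 1) F = F.coeff (Finsupp.single i d) := by
  have hprod : ∀ m ∈ F.support, m ≠ Finsupp.single i d →
      F.coeff m * ∏ j, Pi.single (M := fun _ => K) i 1 j ^ m j = 0 := by
    intro m hm hne
    obtain ⟨j, hji, hj⟩ : ∃ j, j ≠ i ∧ m j ≠ 0 := by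
      by_contra! h
      refine hne (Finsupp.ext fun j => ?_)
      rcases eq_or_ne j i with rfl | hji
      · rw [Finsupp.single_eq_same, ← sum_eq_of_mem_support hF hm,
          Finset.sum_eq_single j (fun k _ hk => h k hk) (by simp)]
      · rw [h j hji, Finsupp.single_eq_of_ne hji]
    rw [Finset.prod_eq_zero (Finset.mem_univ j) (by simp [hji, hj]), mul_zero]
  rw [MvPolynomial.eval_eq', Finset.sum_eq_single (Finsupp.single i d) hprod]
  · rw [Finset.prod_eq_one, mul_one]
    intro j _
    rcases eq_or_ne j i with rfl | hji
    · simp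
    · simp [Finsupp.single_eq_of_ne hji]
  · simp +contextual

end HomogeneousForms

section HermitianCurve

open MvPolynomial

theorem span_monomials_eq_top {K Z : Type*} [Field K] [Finite K] {x y : Z → K}
    (hxy : Function.Injective fun z => (x z, y z)) :
    span K (Set.range fun m : ℕ × ℕ => x ^ m.1 * y ^ m.2) = ⊤ := by
  have := Fintype.ofFinite K
  refine eq_top_iff.2 fun f _ => ?_
  have hinj : Function.Injective fun z => ![x z, y z] := fun z z' h =>
    hxy (Prod.ext (congr_fun h 0) (congr_fun h 1))
  obtain ⟨p, -, hp⟩ : Function.extend (fun z => ![x z, y z]) f 0 ∈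
      (restrictDegree (Fin 2) K (Fintype.card K - 1)).map (evalₗ K (Fin 2)) := by
    rw [map_restrict_dom_evalₗ]
    trivial
  have hf : f = ∑ m ∈ p.support, p.coeff m • (x ^ m 0 * y ^ m 1) := by
    funext z
    have hz := congr_fun hp ![x z, y z]
    rw [hinj.extend_apply, evalₗ_apply, eval_eq'] at hz
    simpa [Finset.sum_apply, Fin.prod_univ_two] using hz.symm
  rw [hf]
  exact sum_mem fun m _ => smul_mem _ _ (subset_span ⟨(m 0, m 1), rfl⟩)

theorem weight_injective_of_sum_eq {q e : ℕ} (heq : e ≤ q) {m n : Fin 3 →₀ ℕ}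
    (hm : ∑ i, m i = e) (hn : ∑ i, n i = e)
    (h : q * m 1 + (q + 1) * m 0 = q * n 1 + (q + 1) * n 0) : m = n := by
  wlog hle : m 0 + m 1 ≤ n 0 + n 1 generalizing m n
  · exact (this hn hm h.symm (le_of_not_ge hle)).symm
  rw [Fin.sum_univ_three] at hm hn
  have hweight : q * (m 0 + m 1) + m 0 = q * (n 0 + n 1) + n 0 := by linarith
  have hsum : m 0 + m 1 = n 0 + n 1 := by
    refine hle.antisymm (le_of_not_gt fun hlt => ?_)
    have hstep := Nat.mul_le_mul_left q (Nat.succ_le_of_lt hlt)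
    rw [Nat.mul_succ] at hstep
    omega
  rw [hsum] at hweight
  ext i
  fin_cases i <;> simp only [Fin.zero_eta, Fin.mk_one, Fin.reduceFinMk] <;> omega

/-- The plane Hermitian curve `y + y ^ q + β x ^ (q + 1) + γ = 0`, in homogeneous coordinates
`(y, x, z)`. Its only point on the line `z = 0` is `(1, 0, 0)`. -/
noncomputable def hermitianCurve {K : Type*} [Field K] (q : ℕ) (β γ : K) :
    MvPolynomial (Fin (2 + 1)) K :=
  X 0 * X 2 ^ q + X 0 ^ q * X 2 + C β * X 1 ^ (q + 1) + C γ * X 2 ^ (q + 1)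

variable {K : Type*} [Field K] {q e : ℕ} {β γ : K}

theorem isHomogeneous_hermitianCurve (q : ℕ) (β γ : K) :
    (hermitianCurve q β γ).IsHomogeneous (q + 1) := by
  have hX (i : Fin (2 + 1)) (k : ℕ) : (X i ^ k : MvPolynomial (Fin (2 + 1)) K).IsHomogeneous k :=
    isHomogeneous_X_pow i k
  refine IsHomogeneous.add (IsHomogeneous.add (IsHomogeneous.add ?_ ?_) ?_) ?_
  · rw [add_comm q]
    exact (isHomogeneous_X K 0).mul (hX 2 q)
  · exact (hX 0 q).mul (isHomogeneous_X K 2)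
  · exact (hX 1 (q + 1)).C_mul β
  · exact (hX 2 (q + 1)).C_mul γ

theorem aeval_hermitianCurve {A : Type*} [CommRing A] [Algebra K A] (v : Fin (2 + 1) → A) :
    aeval v (hermitianCurve q β γ) = v 0 * v 2 ^ q + v 0 ^ q * v 2 +
      algebraMap K A β * v 1 ^ (q + 1) + algebraMap K A γ * v 2 ^ (q + 1) := by
  simp [hermitianCurve]

/-- The point `(1, 0, 0)` of the projective plane. -/
noncomputable def infinity (K : Type*) [Field K] : Projectivization K (Fin (2 + 1) → K) :=
  Projectivization.mk K (Pi.single 0 1) (by simp)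

theorem exists_eq_mk_of_mem_hermitianCurve (hq : q ≠ 0) (hβ : β ≠ 0)
    {p : Projectivization K (Fin (2 + 1) → K)} (hp : p ∈ zeroLocus (hermitianCurve q β γ) K)
    (hne : p ≠ infinity K) :
    ∃ x y, p = Projectivization.mk K ![y, x, 1] (fun h => one_ne_zero (congr_fun h 2)) := by
  induction p with | h v hv =>
  rw [mk_mem_zeroLocus_iff (isHomogeneous_hermitianCurve q β γ), aeval_hermitianCurve] at hp
  have hv2 : v 2 ≠ 0 := by
    intro hv2
    have hv1 : v 1 = 0 := by simpa [hv2, hq, hβ] using hp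
    refine hne ((Projectivization.mk_eq_mk_iff' K _ _ _ _).2 ⟨v 0, ?_⟩)
    ext i
    fin_cases i <;> simp [hv1, hv2]
  refine ⟨v 1 / v 2, v 0 / v 2, (Projectivization.mk_eq_mk_iff' K _ _ _ _).2 ⟨v 2, ?_⟩⟩
  ext i
  fin_cases i <;> simp [mul_div_cancel₀, hv2]

theorem aeval_eq_sum_smul_monomial {A : Type*} [CommRing A] [Algebra K A] (x y : A)
    (G : MvPolynomial (Fin (2 + 1)) K) :
    aeval ![y, x, 1] G = ∑ n ∈ G.support, G.coeff n • (x ^ n 1 * y ^ n 0) := by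
  simp [aeval_def, eval₂_eq', Fin.prod_univ_three, Algebra.smul_def, mul_comm (x ^ _)]

theorem exists_monomial_mem_weightLT (heq : e ≤ q) {G : MvPolynomial (Fin (2 + 1)) K}
    (hG0 : G ≠ 0) (hG : G.IsHomogeneous e) {A : Type*} [CommRing A] [Algebra K A] {x y : A}
    (hzero : aeval ![y, x, 1] G = 0) :
    ∃ m ∈ G.support, x ^ m 1 * y ^ m 0 ∈
      weightLT K q (q + 1) x y (q * m 1 + (q + 1) * m 0) := by
  obtain ⟨m, hm, hmax⟩ := Finset.exists_max_image G.support
    (fun m => q * m 1 + (q + 1) * m 0) (support_nonempty.2 hG0)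
  refine ⟨m, hm, (smul_mem_iff _ (mem_support_iff.1 hm)).1 ?_⟩
  rw [aeval_eq_sum_smul_monomial, ← Finset.add_sum_erase _ _ hm] at hzero
  rw [eq_neg_of_add_eq_zero_left hzero]
  refine neg_mem (sum_mem fun n hn => smul_mem _ _ (monomial_mem_weightLT ?_))
  obtain ⟨hne, hn⟩ := Finset.mem_erase.1 hn
  refine lt_of_le_of_ne (hmax n hn) fun h => hne ?_
  exact weight_injective_of_sum_eq heq (sum_eq_of_mem_support hG hn)
    (sum_eq_of_mem_support hG hm) h

theorem pow_sub_smul_pow_mem_weightLT_of_hermitianCurve (hq : 2 ≤ q) {A : Type*} [CommRing A]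
    [Algebra K A] {x y : A} (hcurve : aeval ![y, x, 1] (hermitianCurve q β γ) = 0) :
    y ^ q - (-β) • x ^ (q + 1) ∈ weightLT K q (q + 1) x y (q * (q + 1)) := by
  have hred : y ^ q - (-β) • x ^ (q + 1) = -(x ^ 0 * y ^ 1 + γ • (x ^ 0 * y ^ 0)) := by
    simp only [aeval_hermitianCurve, Fin.isValue, Matrix.cons_val_zero, Matrix.cons_val_one,
      Matrix.cons_val, one_pow, mul_one] at hcurve
    simp only [Algebra.smul_def, map_neg]
    linear_combination hcurve
  rw [hred]
  refine neg_mem (add_mem (monomial_mem_weightLT ?_) (smul_mem _ _ (monomial_mem_weightLT ?_)))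
  · nlinarith
  · nlinarith

theorem exists_ncard_hermitianCurve_inter_sdiff_le [Finite K] (hq : 2 ≤ q) (hβ : β ≠ 0)
    (heq : e ≤ q) {G : MvPolynomial (Fin (2 + 1)) K} (hG0 : G ≠ 0) (hG : G.IsHomogeneous e) :
    ∃ m ∈ G.support,
      ((zeroLocus (hermitianCurve q β γ) K ∩ zeroLocus G K) \ {infinity K}).ncard ≤
        q * m 1 + (q + 1) * m 0 := by
  set Z := (zeroLocus (hermitianCurve q β γ) K ∩ zeroLocus G K) \ {infinity K}
  have hcoords : ∀ p : Z, ∃ x y, p.1 =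
      Projectivization.mk K ![y, x, 1] (fun h => one_ne_zero (congr_fun h 2)) :=
    fun p => exists_eq_mk_of_mem_hermitianCurve (by omega) hβ p.2.1.1 p.2.2
  choose x y hxy using hcoords
  have hinj : Function.Injective fun p => (x p, y p) := by
    intro p p' h
    obtain ⟨hx, hy⟩ := Prod.ext_iff.1 h
    ext1
    rw [hxy p, hxy p']
    simp only [show x p = x p' from hx, show y p = y p' from hy]
  have hvanish {d : ℕ} {F : MvPolynomial (Fin (2 + 1)) K} (hF : F.IsHomogeneous d)
      (hZ : Z ⊆ zeroLocus F K) : aeval ![y, x, 1] F = 0 := by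
    funext p
    have hp := hZ p.2
    rw [hxy p, mk_mem_zeroLocus_iff hF] at hp
    have hcoord : ![y p, x p, 1] = fun i => Pi.evalAlgHom K _ p (![y, x, 1] i) := by
      ext i
      fin_cases i <;> rfl
    rwa [hcoord, ← comp_aeval_apply] at hp
  obtain ⟨m, hm, hlead⟩ := exists_monomial_mem_weightLT heq hG0 hG
    (hvanish hG fun p hp => hp.1.2)
  have hcurve := hvanish (isHomogeneous_hermitianCurve q β γ) fun p hp => hp.1.1
  have := Fintype.ofFinite Z
  refine ⟨m, hm, ?_⟩
  calc Z.ncard = Module.finrank K (Z → K) := by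
        rw [Module.finrank_fintype_fun_eq_card, ← Nat.card_eq_fintype_card, Nat.card_coe_set_eq]
    _ ≤ _ := finrank_le_weight (neg_ne_zero.2 hβ)
      (pow_sub_smul_pow_mem_weightLT_of_hermitianCurve hq hcurve) (by simp) q.succ_ne_zero hlead
      (span_monomials_eq_top hinj)

theorem ncard_hermitianCurve_inter_le [Finite K] (hq : 2 ≤ q) (hβ : β ≠ 0) (heq : e ≤ q)
    {G : MvPolynomial (Fin (2 + 1)) K} (hG0 : G ≠ 0) (hG : G.IsHomogeneous e) :
    (zeroLocus (hermitianCurve q β γ) K ∩ zeroLocus G K).ncard ≤ e * (q + 1) := by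
  obtain ⟨m, hm, hle⟩ := exists_ncard_hermitianCurve_inter_sdiff_le (γ := γ) hq hβ heq hG0 hG
  have hsum := sum_eq_of_mem_support hG hm
  rw [Fin.sum_univ_three] at hsum
  have hweight : q * m 1 + (q + 1) * m 0 + q * m 2 + m 1 + m 2 = e * (q + 1) := by
    rw [← hsum]
    ring
  by_cases hinf : infinity K ∈ zeroLocus (hermitianCurve q β γ) K ∩ zeroLocus G K
  · have hm0 : m 1 + m 2 ≠ 0 := by
      intro h
      have hcoeff := hinf.2
      rw [infinity, mk_mem_zeroLocus_iff hG, aeval_eq_eval, eval_single_eq_coeff hG] at hcoeff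
      refine mem_support_iff.1 hm ?_
      convert hcoeff
      ext i
      fin_cases i <;> simp <;> omega
    have := Set.ncard_sdiff_singleton_add_one hinf
    omega
  · rw [Set.sdiff_singleton_eq_self hinf] at hle
    nlinarith

theorem infinity_mem_hermitianCurve (hq : q ≠ 0) :
    infinity K ∈ zeroLocus (hermitianCurve q β γ) K := by
  rw [infinity, mk_mem_zeroLocus_iff (isHomogeneous_hermitianCurve q β γ), aeval_hermitianCurve]
  simp [hq]

theorem ncard_hermitianCurve_le [Finite K] (hq : 2 ≤ q) (hβ : β ≠ 0) :
    (zeroLocus (hermitianCurve q β γ) K).ncard ≤ Nat.card K * q + 1 := by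
  set U := zeroLocus (hermitianCurve q β γ) K
  let line (x : K) : MvPolynomial (Fin (2 + 1)) K := X 1 - C x * X 2
  have hline (x : K) : (line x).IsHomogeneous 1 :=
    (isHomogeneous_X K 1).sub (isHomogeneous_C_mul_X x 2)
  have hline0 (x : K) : line x ≠ 0 := fun h => by
    simpa [line] using congr_arg (eval ![0, 1, 0]) h
  have hinfU : infinity K ∈ U := infinity_mem_hermitianCurve (by omega)
  have hinf (x : K) : infinity K ∈ U ∩ zeroLocus (line x) K :=
    ⟨hinfU, (mk_mem_zeroLocus_iff (hline x) K _ _).2 (by simp [line])⟩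
  have hcover : U \ {infinity K} ⊆ ⋃ x, (U ∩ zeroLocus (line x) K) \ {infinity K} := by
    rintro p ⟨hp, hne⟩
    obtain ⟨x, y, rfl⟩ := exists_eq_mk_of_mem_hermitianCurve (by omega) hβ hp hne
    exact Set.mem_iUnion.2
      ⟨x, ⟨hp, (mk_mem_zeroLocus_iff (hline x) K _ _).2 (by simp [line])⟩, hne⟩
  have hcount (x : K) : ((U ∩ zeroLocus (line x) K) \ {infinity K}).ncard ≤ q := by
    have hle : (U ∩ zeroLocus (line x) K).ncard ≤ 1 * (q + 1) :=
      ncard_hermitianCurve_inter_le hq hβ (by omega) (hline0 x) (hline x)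
    have := Set.ncard_sdiff_singleton_add_one (hinf x)
    omega
  have := Fintype.ofFinite K
  calc U.ncard = (U \ {infinity K}).ncard + 1 :=
        (Set.ncard_sdiff_singleton_add_one hinfU).symm
    _ ≤ (⋃ x, (U ∩ zeroLocus (line x) K) \ {infinity K}).ncard + 1 := by
      gcongr
      exact Set.toFinite _
    _ ≤ Nat.card K * q + 1 := by
      gcongr
      calc (⋃ x, (U ∩ zeroLocus (line x) K) \ {infinity K}).ncard ≤ ∑ _x : K, q :=
            (Set.ncard_iUnion_le_of_fintype _).trans (Finset.sum_le_sum fun x _ => hcount x)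
        _ = Nat.card K * q := by simp

end HermitianCurve

section Cone

variable {K : Type*} [Field K] {n d : ℕ}

/-- The cone over `C ⊆ ℙⁿ` with vertex `(1, 0, …, 0)` in `ℙⁿ⁺¹`: the vertex together with the points
whose projection from the vertex lies in `C`. -/
def coneOver (C : Set (Projectivization K (Fin (n + 1) → K))) :
    Set (Projectivization K (Fin (n + 1 + 1) → K)) :=
  {p | ∀ h : Fin.tail p.rep ≠ 0, Projectivization.mk K (Fin.tail p.rep) h ∈ C}

theorem mk_mem_coneOver_iff {C : Set (Projectivization K (Fin (n + 1) → K))}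
    {v : Fin (n + 1 + 1) → K} (hv : v ≠ 0) :
    Projectivization.mk K v hv ∈ coneOver C ↔
      ∀ h : Fin.tail v ≠ 0, Projectivization.mk K (Fin.tail v) h ∈ C := by
  obtain ⟨a, ha⟩ := Projectivization.exists_smul_eq_mk_rep K v hv
  have htail : Fin.tail (Projectivization.mk K v hv).rep = a • Fin.tail v := by
    rw [← ha]
    rfl
  have hmk (h : Fin.tail v ≠ 0) (h' : a • Fin.tail v ≠ 0) :
      Projectivization.mk K (a • Fin.tail v) h' = Projectivization.mk K (Fin.tail v) h :=
    (Projectivization.mk_eq_mk_iff K _ _ h' h).2 ⟨a, rfl⟩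
  simp only [coneOver, Set.mem_ofPred_eq, htail]
  constructor
  · intro hC h
    have h' := (smul_ne_zero_iff_ne a).2 h
    exact hmk h h' ▸ hC h'
  · intro hC h'
    have h := (smul_ne_zero_iff_ne a).1 h'
    exact (hmk h h').symm ▸ hC h

theorem mk_mem_coneOver_zeroLocus_iff {G : MvPolynomial (Fin (n + 1)) K}
    (hG : G.IsHomogeneous d) (hd : d ≠ 0) {v : Fin (n + 1 + 1) → K} (hv : v ≠ 0) :
    Projectivization.mk K v hv ∈ coneOver (zeroLocus G K) ↔
      MvPolynomial.aeval (Fin.tail v) G = 0 := by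
  rw [mk_mem_coneOver_iff]
  by_cases h : Fin.tail v = 0
  · simp only [h, ne_eq, not_true_eq_false, IsEmpty.forall_iff, true_iff]
    rw [MvPolynomial.aeval_zero, MvPolynomial.constantCoeff_eq,
      hG.coeff_eq_zero (by simpa using hd.symm), map_zero]
  · simp only [ne_eq, h, not_false_eq_true, forall_true_left]
    exact mk_mem_zeroLocus_iff hG K _ h

theorem cons_ne_zero {s : Fin (n + 1) → K} (hs : s ≠ 0) (t : K) :
    (Fin.cons t s : Fin (n + 1 + 1) → K) ≠ 0 :=
  fun h => hs (congr_arg Fin.tail h)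

theorem coneOver_inter_zeroLocus_subset {C : Set (Projectivization K (Fin (n + 1) → K))}
    {F : MvPolynomial (Fin (n + 1 + 1)) K} (hF : F.IsHomogeneous d) :
    coneOver C ∩ zeroLocus F K ⊆ {Projectivization.mk K (Pi.single 0 1) (by simp)} ∪
      ⋃ p ∈ C, (fun t => Projectivization.mk K (Fin.cons t p.rep) (cons_ne_zero p.rep_nonzero t)) ''
        {t | MvPolynomial.eval (Fin.cons t p.rep) F = 0} := by
  rintro x ⟨hxC, hxF⟩
  induction x with | h v hv =>
  by_cases htail : Fin.tail v = 0
  · refine Or.inl ((Projectivization.mk_eq_mk_iff' K _ _ _ _).2 ⟨v 0, ?_⟩)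
    ext i
    refine Fin.cases (by simp) (fun i => ?_) i
    simpa [Fin.tail] using (congr_fun htail i).symm
  · set p := Projectivization.mk K (Fin.tail v) htail
    obtain ⟨a, ha⟩ := Projectivization.exists_smul_eq_mk_rep K (Fin.tail v) htail
    have hcons : (Fin.cons (a * v 0) p.rep : Fin (n + 1 + 1) → K) = a • v := by
      rw [← ha]
      ext i
      refine Fin.cases ?_ (fun i => ?_) i <;> rfl
    have hmk : Projectivization.mk K (Fin.cons (a * v 0) p.rep) (cons_ne_zero p.rep_nonzero _) =
        Projectivization.mk K v hv :=
      (Projectivization.mk_eq_mk_iff K _ _ _ _).2 ⟨a, hcons.symm⟩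
    refine Or.inr (Set.mem_biUnion ((mk_mem_coneOver_iff hv).1 hxC htail) ⟨a * v 0, ?_, hmk⟩)
    rw [← hmk, mk_mem_zeroLocus_iff hF] at hxF
    exact hxF

theorem ncard_setOf_eval_cons_eq_zero_le {F : MvPolynomial (Fin (n + 1)) K} {s : Fin n → K}
    (h : MvPolynomial.eval s (MvPolynomial.finSuccEquiv K n F).leadingCoeff ≠ 0) :
    {t : K | MvPolynomial.eval (Fin.cons t s) F = 0}.ncard ≤
      (MvPolynomial.finSuccEquiv K n F).natDegree := by
  classical
  set P := MvPolynomial.finSuccEquiv K n F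
  have hmap : P.map (MvPolynomial.eval s) ≠ 0 := fun h0 => h <| by
    simpa [Polynomial.coeff_map] using congr_arg (Polynomial.coeff · P.natDegree) h0
  have hroots : {t : K | MvPolynomial.eval (Fin.cons t s) F = 0} =
      (P.map (MvPolynomial.eval s)).roots.toFinset := by
    ext t
    simp [hmap, MvPolynomial.eval_eq_eval_mv_eval', P]
  rw [hroots, Set.ncard_coe_finset]
  calc _ ≤ (P.map (MvPolynomial.eval s)).roots.card := Multiset.toFinset_card_le _
    _ ≤ (P.map (MvPolynomial.eval s)).natDegree := Polynomial.card_roots' _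
    _ ≤ P.natDegree := Polynomial.natDegree_map_le

theorem ncard_coneOver_inter_zeroLocus_le [Finite K]
    (C : Set (Projectivization K (Fin (n + 1) → K))) {F : MvPolynomial (Fin (n + 1 + 1)) K}
    (hF : F.IsHomogeneous d) {G : MvPolynomial (Fin (n + 1)) K}
    (hG : G = (MvPolynomial.finSuccEquiv K (n + 1) F).leadingCoeff) :
    (coneOver C ∩ zeroLocus F K).ncard ≤ 1 + ((C ∩ zeroLocus G K).ncard * Nat.card K +
      (C \ zeroLocus G K).ncard * (MvPolynomial.finSuccEquiv K (n + 1) F).natDegree) := by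
  classical
  set k := (MvPolynomial.finSuccEquiv K (n + 1) F).natDegree
  have := Fintype.ofFinite (Projectivization K (Fin (n + 1) → K))
  let join (p : Projectivization K (Fin (n + 1) → K)) :
      Set (Projectivization K (Fin (n + 1 + 1) → K)) :=
    (fun t => Projectivization.mk K (Fin.cons t p.rep) (cons_ne_zero p.rep_nonzero t)) ''
      {t | MvPolynomial.eval (Fin.cons t p.rep) F = 0}
  have hjoin (p : Projectivization K (Fin (n + 1) → K)) :
      (join p).ncard ≤ if p ∈ zeroLocus G K then Nat.card K else k := by
    refine (Set.ncard_image_le (Set.toFinite _)).trans ?_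
    split_ifs with h
    · exact (Set.ncard_le_ncard (Set.subset_univ _)).trans_eq (Set.ncard_univ K)
    · exact ncard_setOf_eval_cons_eq_zero_le (hG ▸ h)
  calc (coneOver C ∩ zeroLocus F K).ncard
      ≤ ({Projectivization.mk K (Pi.single 0 1) (by simp)} ∪ ⋃ p ∈ C.toFinset, join p).ncard :=
        Set.ncard_le_ncard (by simpa using coneOver_inter_zeroLocus_subset hF)
    _ ≤ 1 + ∑ p ∈ C.toFinset, (join p).ncard :=
        (Set.ncard_union_le _ _).trans (add_le_add (Set.ncard_singleton _).le
          (Finset.set_ncard_biUnion_le _ _))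
    _ ≤ 1 + ∑ p ∈ C.toFinset, if p ∈ zeroLocus G K then Nat.card K else k := by
        gcongr with p
        exact hjoin p
    _ = 1 + ((C ∩ zeroLocus G K).ncard * Nat.card K + (C \ zeroLocus G K).ncard * k) := by
        rw [Finset.sum_ite, Finset.sum_const, Finset.sum_const, smul_eq_mul, smul_eq_mul,
          ← Set.ncard_coe_finset, ← Set.ncard_coe_finset]
        congr <;> ext <;> simp

theorem eval_cons_eq_of_natDegree_eq_zero {F : MvPolynomial (Fin (n + 1)) K}
    (h : (MvPolynomial.finSuccEquiv K n F).natDegree = 0) (t t' : K) (s : Fin n → K) :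
    MvPolynomial.eval (Fin.cons t s) F = MvPolynomial.eval (Fin.cons t' s) F := by
  rw [MvPolynomial.eval_eq_eval_mv_eval', MvPolynomial.eval_eq_eval_mv_eval',
    Polynomial.eq_C_of_natDegree_eq_zero h, Polynomial.map_C, Polynomial.eval_C, Polynomial.eval_C]

theorem eq_zero_of_cone_count {q k c n m : ℕ} (hq : 2 ≤ q) (hkc : k + c ≤ q)
    (hn : n ≤ c * (q + 1)) (hnm : n + m ≤ q ^ 3 + 1)
    (hcount : q ^ 2 * ((k + c) * (q + 1)) ≤ n * q ^ 2 + m * k) : k = 0 := by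
  by_contra hk0
  have hk1 : 1 ≤ k := Nat.one_le_iff_ne_zero.2 hk0
  zify at *
  have hkq : (k : ℤ) ≤ q ^ 2 := by nlinarith
  have hupper : (n * q ^ 2 + m * k : ℤ) ≤ c * (q + 1) * (q ^ 2 - k) + (q ^ 3 + 1) * k :=
    calc (n * q ^ 2 + m * k : ℤ) = n * (q ^ 2 - k) + (n + m) * k := by ring
      _ ≤ c * (q + 1) * (q ^ 2 - k) + (q ^ 3 + 1) * k := by gcongr
  have hgap : (0 : ℤ) < k * (q ^ 2 - 1) := mul_pos (by linarith) (by nlinarith)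
  have hgap' : (0 : ℤ) ≤ k * (c * (q + 1)) := by positivity
  linarith

theorem two_le_of_card_eq_sq [Finite K] {q : ℕ} (hq : Nat.card K = q ^ 2) : 2 ≤ q := by
  have := Finite.one_lt_card (α := K)
  nlinarith

theorem natDegree_finSuccEquiv_eq_zero_of_le_ncard [Finite K] {q : ℕ} (hq : Nat.card K = q ^ 2)
    (hdq : d ≤ q) {β γ : K} (hβ : β ≠ 0) {F : MvPolynomial (Fin (2 + 1 + 1)) K} (hF0 : F ≠ 0)
    (hF : F.IsHomogeneous d) (hcard : 1 + q ^ 2 * (d * (q + 1)) ≤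
      (coneOver (zeroLocus (hermitianCurve q β γ) K) ∩ zeroLocus F K).ncard) :
    (MvPolynomial.finSuccEquiv K (2 + 1) F).natDegree = 0 := by
  have hq2 := two_le_of_card_eq_sq hq
  set P := MvPolynomial.finSuccEquiv K (2 + 1) F
  have hkd : P.natDegree ≤ d := by
    rw [MvPolynomial.natDegree_finSuccEquiv]
    exact (MvPolynomial.degreeOf_le_totalDegree F 0).trans hF.totalDegree_le
  have hG0 : P.leadingCoeff ≠ 0 := by simpa [P] using hF0
  have hG : P.leadingCoeff.IsHomogeneous (d - P.natDegree) :=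
    hF.finSuccEquiv_coeff_isHomogeneous _ _ (Nat.add_sub_cancel' hkd)
  set U := zeroLocus (hermitianCurve q β γ) K
  have hbezout : (U ∩ zeroLocus P.leadingCoeff K).ncard ≤ (d - P.natDegree) * (q + 1) :=
    ncard_hermitianCurve_inter_le hq2 hβ ((Nat.sub_le _ _).trans hdq) hG0 hG
  have hU : (U ∩ zeroLocus P.leadingCoeff K).ncard + (U \ zeroLocus P.leadingCoeff K).ncard ≤
      q ^ 3 + 1 := by
    rw [Set.ncard_inter_add_ncard_sdiff_eq_ncard]
    exact (ncard_hermitianCurve_le hq2 hβ).trans_eq (by rw [hq]; ring)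
  have hcone := ncard_coneOver_inter_zeroLocus_le U hF rfl
  rw [hq] at hcone
  refine eq_zero_of_cone_count hq2 (by omega) hbezout hU ?_
  rw [Nat.add_sub_cancel' hkd]
  exact Nat.le_of_add_le_add_left (hcard.trans hcone)

end Cone

section LinearChange

variable {K : Type*} [Field K] {n d : ℕ} {F : MvPolynomial (Fin (n + 1)) K}

theorem bind₁_toMvPolynomial_bind₁_toMvPolynomial {M N : Matrix (Fin (n + 1)) (Fin (n + 1)) K}
    (h : M * N = 1) (F : MvPolynomial (Fin (n + 1)) K) :
    MvPolynomial.bind₁ N.toMvPolynomial (MvPolynomial.bind₁ M.toMvPolynomial F) = F := by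
  simp only [MvPolynomial.bind₁_bind₁, ← Matrix.toMvPolynomial_mul, h, Matrix.toMvPolynomial_one,
    MvPolynomial.bind₁_X_left, AlgHom.id_apply]

theorem exists_eval_eq_eval_linearEquiv (hF0 : F ≠ 0) (hF : F.IsHomogeneous d)
    (φ : (Fin (n + 1) → K) ≃ₗ[K] (Fin (n + 1) → K)) :
    ∃ F' : MvPolynomial (Fin (n + 1)) K, F' ≠ 0 ∧ F'.IsHomogeneous d ∧
      ∀ v, MvPolynomial.eval v F' = MvPolynomial.eval (φ v) F := by
  set M := LinearMap.toMatrix' (φ : (Fin (n + 1) → K) →ₗ[K] (Fin (n + 1) → K))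
  have hM : M * LinearMap.toMatrix' (φ.symm : (Fin (n + 1) → K) →ₗ[K] (Fin (n + 1) → K)) = 1 := by
    rw [← LinearMap.toMatrix'_comp]
    simp
  refine ⟨MvPolynomial.bind₁ M.toMvPolynomial F, fun h => hF0 ?_, ?_, fun v => ?_⟩
  · rw [← bind₁_toMvPolynomial_bind₁_toMvPolynomial hM F, h, map_zero]
  · simpa using hF.aeval M.toMvPolynomial M.toMvPolynomial_isHomogeneous
  · have hsubst : (fun i => MvPolynomial.aeval v (M.toMvPolynomial i)) = φ v := by
      funext i
      rw [MvPolynomial.aeval_eq_eval, Matrix.toMvPolynomial_eval_eq_apply,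
        LinearMap.toMatrix'_mulVec]
      rfl
    rw [← MvPolynomial.coe_aeval_eq_eval, RingHom.coe_coe, MvPolynomial.aeval_bind₁, hsubst]
    rfl

theorem ncard_preimage_projectivization_map {V W : Type*} [AddCommGroup V] [Module K V]
    [AddCommGroup W] [Module K W] (φ : V ≃ₗ[K] W) (X : Set (Projectivization K W)) :
    (Projectivization.map (φ : V →ₗ[K] W) φ.injective ⁻¹' X).ncard = X.ncard := by
  refine Set.ncard_preimage_of_injective_subset_range
    (Projectivization.map_injective _ φ.injective) fun p _ => ?_
  induction p with | h w hw =>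
  exact ⟨Projectivization.mk K (φ.symm w) (φ.symm.map_ne_zero_iff.2 hw), by
    simp [Projectivization.map_mk]⟩

theorem preimage_zeroLocus_of_eval_eq {F' : MvPolynomial (Fin (n + 1)) K}
    (hF : F.IsHomogeneous d) (hF' : F'.IsHomogeneous d)
    (φ : (Fin (n + 1) → K) ≃ₗ[K] (Fin (n + 1) → K))
    (h : ∀ v, MvPolynomial.eval v F' = MvPolynomial.eval (φ v) F) :
    Projectivization.map (φ : (Fin (n + 1) → K) →ₗ[K] (Fin (n + 1) → K)) φ.injective ⁻¹'
      zeroLocus F K = zeroLocus F' K := by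
  ext p
  induction p with | h v hv =>
  rw [Set.mem_preimage, Projectivization.map_mk, mk_mem_zeroLocus_iff hF, mk_mem_zeroLocus_iff hF']
  exact (h v).symm ▸ Iff.rfl

end LinearChange

section HermitianForms

variable {K V : Type*} [Field K] [AddCommGroup V] [Module K V]

theorem finrank_span_pair {r v : V} (hr : r ≠ 0) (hv : v ∉ span K {r}) :
    Module.finrank K (span K {r, v}) = 2 := by
  have hli : LinearIndependent K ![r, v] :=
    (LinearIndependent.pair_iff' hr).2 fun a h => hv (mem_span_singleton.2 ⟨a, h⟩)
  rw [← Matrix.range_cons_cons_empty r v ![], finrank_span_eq_card hli, Fintype.card_fin]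

theorem span_pair_eq_of_finrank_eq_two {W : Submodule K V} (hW : Module.finrank K W = 2) {r v : V}
    (hr : r ≠ 0) (hv : v ∉ span K {r}) (hrW : r ∈ W) (hvW : v ∈ W) : span K {r, v} = W := by
  have := Module.finite_of_finrank_eq_succ hW
  refine Submodule.eq_of_le_of_finrank_eq (span_le.2 ?_) ((finrank_span_pair hr hv).trans hW.symm)
  simp [Set.insert_subset_iff, hrW, hvW]

theorem exists_mem_notMem_span_singleton {W : Submodule K V} (hW : 1 < Module.finrank K W) (r : V) :
    ∃ v ∈ W, v ∉ span K {r} := by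
  by_contra! h
  exact hW.not_ge ((Submodule.finrank_mono h).trans ((finrank_span_le_card _).trans (by simp)))

variable {σ : K →+* K} {B : V →ₛₗ[σ] V →ₗ[K] K}

theorem apply_eq_zero_of_mem_span {s : Set V} (h : ∀ x ∈ s, ∀ y ∈ s, B x y = 0) {x y : V}
    (hx : x ∈ span K s) (hy : y ∈ span K s) : B x y = 0 := by
  have hright : ∀ x ∈ s, B x y = 0 := fun x hx =>
    (span_le (p := (B x).ker)).2 (fun z hz => h x hx z hz) hy
  exact (span_le (p := (B.flip y).ker)).2 hright hx

theorem apply_eq_zero_of_isotropic (hB : B.IsSymm) (hσ : ∃ a, a + σ a ≠ 0) {W : Submodule K V}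
    (hW : ∀ x ∈ W, B x x = 0) {x y : V} (hx : x ∈ W) (hy : y ∈ W) : B x y = 0 := by
  obtain ⟨a, ha⟩ := hσ
  by_contra hxy
  obtain ⟨z, hz, hxz⟩ : ∃ z ∈ W, B x z = a :=
    ⟨(a / B x y) • y, W.smul_mem _ hy, by simp [hxy]⟩
  refine ha ?_
  calc a + σ a = B (x + z) (x + z) := by simp [hW x hx, hW z hz, hxz, ← hB.eq x z, add_comm]
    _ = 0 := hW _ (W.add_mem hx hz)

section HyperbolicPair

variable {v w : V}

theorem finrank_ker_inf_ker_add_two [Module.Finite K V] (hvv : B v v = 0) (hvw : B v w = 1)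
    (hwv : B w v = 1) :
    Module.finrank K ↥((B v).ker ⊓ (B w).ker) + 2 = Module.finrank K V := by
  have hsurj : Function.Surjective ((B v).prod (B w)) := fun c =>
    ⟨(c.2 - c.1 * B w w) • v + c.1 • w, by simp [hvv, hvw, hwv]⟩
  rw [← LinearMap.ker_prod, add_comm, ← LinearMap.finrank_range_add_finrank_ker ((B v).prod (B w)),
    LinearMap.range_eq_top.2 hsurj, finrank_top, Module.finrank_prod, Module.finrank_self]

theorem exists_mem_ker_inf_ker_eq_add (hvv : B v v = 0) (hvw : B v w = 1) (hwv : B w v = 1)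
    (x : V) : ∃ m ∈ (B v).ker ⊓ (B w).ker, ∃ y z : K, x = m + y • v + z • w := by
  refine ⟨x - (B w x - B v x * B w w) • v - B v x • w, ?_, _, _, by abel⟩
  simp [hvv, hvw, hwv]

theorem exists_span_pair_eq_ker_inf_ker (hV : Module.finrank K V = 4) (hB : B.IsSymm) {r : V}
    (hr : r ≠ 0) (hker : B.ker = span K {r}) (hvv : B v v = 0) (hvw : B v w = 1) :
    ∃ u, span K {r, u} = (B v).ker ⊓ (B w).ker ∧ B u u ≠ 0 := by
  have := Module.finite_of_finrank_eq_succ hV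
  have hwv : B w v = 1 := by rw [← hB.eq, hvw, map_one]
  have hrB (x : V) : B x r = 0 := by
    rw [hB.eq_iff, LinearMap.mem_ker.1 (hker.ge (mem_span_singleton_self r)), LinearMap.zero_apply]
  have hrank : Module.finrank K ↥((B v).ker ⊓ (B w).ker) = 2 := by
    have := finrank_ker_inf_ker_add_two hvv hvw hwv
    omega
  obtain ⟨u, hu, hur⟩ := exists_mem_notMem_span_singleton (by rw [hrank]; omega) r
  have hspan := span_pair_eq_of_finrank_eq_two hrank hr hur ⟨hrB v, hrB w⟩ hu
  refine ⟨u, hspan, fun huu => hur (hker ▸ LinearMap.mem_ker.2 (LinearMap.ext fun x => ?_))⟩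
  obtain ⟨m, hm, y, z, rfl⟩ := exists_mem_ker_inf_ker_eq_add hvv hvw hwv x
  rw [← hspan] at hm
  obtain ⟨a, b, rfl⟩ := mem_span_pair.1 hm
  simp [hrB, huu, hB.eq_iff.1 hu.1, hB.eq_iff.1 hu.2]

theorem span_range_eq_top_of_span_pair_eq (hvv : B v v = 0) (hvw : B v w = 1) (hwv : B w v = 1)
    {r u : V} (hspan : span K {r, u} = (B v).ker ⊓ (B w).ker) :
    span K (Set.range ![r, v, u, w]) = ⊤ := by
  rw [eq_top_iff]
  rintro x -
  obtain ⟨m, hm, y, z, rfl⟩ := exists_mem_ker_inf_ker_eq_add hvv hvw hwv x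
  rw [← hspan] at hm
  obtain ⟨a, c, rfl⟩ := mem_span_pair.1 hm
  have hmem (i : Fin 4) : ![r, v, u, w] i ∈ span K (Set.range ![r, v, u, w]) :=
    subset_span ⟨i, rfl⟩
  exact add_mem (add_mem (add_mem (smul_mem _ _ (hmem 0)) (smul_mem _ _ (hmem 2)))
    (smul_mem _ _ (hmem 1))) (smul_mem _ _ (hmem 3))

end HyperbolicPair

theorem exists_basis_apply_eq (hV : Module.finrank K V = 4) (hB : B.IsSymm) {r : V} (hr : r ≠ 0)
    (hker : B.ker = span K {r}) {v : V} (hvv : B v v = 0) (hv : v ∉ span K {r}) :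
    ∃ b : Module.Basis (Fin 4) K V, b 0 = r ∧ b 1 = v ∧ (∀ x, B v x = b.repr x 3) ∧
      ∃ β γ, β ≠ 0 ∧ ∀ x, B x x = b.repr x 1 * σ (b.repr x 3) + σ (b.repr x 1) * b.repr x 3 +
        β * (σ (b.repr x 2) * b.repr x 2) + γ * (σ (b.repr x 3) * b.repr x 3) := by
  obtain ⟨w, hvw⟩ : ∃ w, B v w = 1 := by
    obtain ⟨x, hx⟩ : ∃ x, B v x ≠ 0 := by
      by_contra! h
      exact hv (hker ▸ LinearMap.mem_ker.2 (LinearMap.ext h))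
    exact ⟨(B v x)⁻¹ • x, by simp [hx]⟩
  have hwv : B w v = 1 := by rw [← hB.eq, hvw, map_one]
  obtain ⟨u, hspan, huu⟩ := exists_span_pair_eq_ker_inf_ker hV hB hr hker hvv hvw
  have htop := span_range_eq_top_of_span_pair_eq hvv hvw hwv hspan
  let b := basisOfTopLeSpanOfCardEqFinrank ![r, v, u, w] htop.ge (by simp [hV])
  have hb : ⇑b = ![r, v, u, w] := coe_basisOfTopLeSpanOfCardEqFinrank _ _ _
  have hsum (x : V) : x = b.repr x 0 • r + b.repr x 1 • v + b.repr x 2 • u + b.repr x 3 • w := by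
    conv_lhs => rw [← b.sum_repr x]
    simp [Fin.sum_univ_four, hb]
  have hr0 : B r = 0 := LinearMap.mem_ker.1 (hker.ge (mem_span_singleton_self r))
  have hrB (x : V) : B x r = 0 := by rw [hB.eq_iff, hr0, LinearMap.zero_apply]
  have hu : B v u = 0 ∧ B w u = 0 := hspan.le (subset_span (by simp))
  have huv : B u v = 0 := hB.eq_iff.1 hu.1
  have huw : B u w = 0 := hB.eq_iff.1 hu.2
  refine ⟨b, by simp [hb], by simp [hb], fun x => ?_, B u u, B w w, huu, fun x => ?_⟩
  · conv_lhs => rw [hsum x]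
    simp [hrB, hvv, hu.1, hvw]
  · conv_lhs => rw [hsum x]
    simp only [map_add, LinearMap.map_smulₛₗ, LinearMap.add_apply, LinearMap.smul_apply, map_smul,
      smul_eq_mul, hr0, hrB, LinearMap.zero_apply, smul_zero, hvv, hu.1, hu.2, huv, huw, hvw, hwv]
    ring

theorem mem_span_pair_of_isotropic (hV : Module.finrank K V = 4) (hB : B.IsSymm) {r : V}
    (hr : r ≠ 0) (hker : B.ker = span K {r}) {v : V} (hvv : B v v = 0) (hv : v ∉ span K {r})
    {x : V} (hxx : B x x = 0) (hvx : B v x = 0) : x ∈ span K {r, v} := by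
  obtain ⟨b, hb0, hb1, hbv, β, γ, hβ, hbB⟩ := exists_basis_apply_eq hV hB hr hker hvv hv
  have hx3 : b.repr x 3 = 0 := (hbv x).symm.trans hvx
  have hx2 : b.repr x 2 = 0 := by simpa [hx3, hβ] using (hbB x).symm.trans hxx
  rw [← b.sum_repr x, Fin.sum_univ_four, hb0, hb1, hx2, hx3, mem_span_pair]
  exact ⟨b.repr x 0, b.repr x 1, by simp⟩

theorem mem_of_ker_eq_span_of_isotropic (hV : Module.finrank K V = 4) (hB : B.IsSymm) {r : V}
    (hr : r ≠ 0) (hker : B.ker = span K {r}) {W : Submodule K V} (hW : Module.finrank K W = 2)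
    (hWB : ∀ x ∈ W, ∀ y ∈ W, B x y = 0) : r ∈ W := by
  obtain ⟨v, hvW, hv⟩ := exists_mem_notMem_span_singleton (by rw [hW]; omega) r
  have := Module.finite_of_finrank_eq_succ hV
  have hle : W ≤ span K {r, v} := fun x hx =>
    mem_span_pair_of_isotropic hV hB hr hker (hWB v hvW v hvW) hv (hWB x hx x hx) (hWB v hvW x hx)
  rw [Submodule.eq_of_le_of_finrank_eq hle (hW.trans (finrank_span_pair hr hv).symm)]
  exact subset_span (Set.mem_insert _ _)

end HermitianForms

section HermitianMatrices

variable {K : Type*} [Field K] {n q : ℕ}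

/-- The sesquilinear form `(x, y) ↦ yᵀ H σ(x)` of a square matrix `H`. Mathlib's convention puts the
semilinear argument first, whence the transpose. -/
noncomputable def sesqForm (σ : K →+* K) (H : Matrix (Fin (n + 1)) (Fin (n + 1)) K) :
    (Fin (n + 1) → K) →ₛₗ[σ] (Fin (n + 1) → K) →ₗ[K] K :=
  Matrix.toLinearMapₛₗ₂' K σ (RingHom.id K) H.transpose

theorem sesqForm_apply (σ : K →+* K) (H : Matrix (Fin (n + 1)) (Fin (n + 1)) K)
    (x y : Fin (n + 1) → K) : sesqForm σ H x y = ∑ i, ∑ j, H i j * y i * σ (x j) := by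
  rw [sesqForm, Matrix.toLinearMapₛₗ₂'_apply, Finset.sum_comm]
  refine Finset.sum_congr rfl fun i _ => Finset.sum_congr rfl fun j _ => ?_
  simp only [RingHom.id_apply, smul_eq_mul, Matrix.transpose_apply]
  ring

theorem isSymm_sesqForm {σ : K →+* K} (hσσ : ∀ a, σ (σ a) = a)
    {H : Matrix (Fin (n + 1)) (Fin (n + 1)) K} (hH : H.transpose = H.map σ) :
    (sesqForm σ H).IsSymm := by
  refine ⟨fun x y => ?_⟩
  rw [sesqForm_apply, sesqForm_apply, Finset.sum_comm, map_sum]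
  refine Finset.sum_congr rfl fun j _ => ?_
  rw [map_sum]
  refine Finset.sum_congr rfl fun i _ => ?_
  have hij : H j i = σ (H i j) := congr_fun₂ hH i j
  rw [map_mul, map_mul, hσσ, hij]
  ring

theorem isSymm_sesqForm_of_isHermitianMatrix [Finite K] (hq : Nat.card K = q ^ 2) {σ : K →+* K}
    (hσ : ∀ a, σ a = a ^ q) {H : Matrix (Fin (n + 1)) (Fin (n + 1)) K}
    (hH : IsHermitianMatrix q H) : (sesqForm σ H).IsSymm := by
  have := Fintype.ofFinite K
  refine isSymm_sesqForm (fun a => ?_) (hH.2.trans (congr_arg H.map (funext hσ).symm))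
  rw [hσ, hσ, ← pow_mul, ← sq, ← hq, Nat.card_eq_fintype_card, FiniteField.pow_card]

theorem ker_sesqForm {σ : K →+* K} {H : Matrix (Fin (n + 1)) (Fin (n + 1)) K}
    (hB : (sesqForm σ H).IsSymm) : (sesqForm σ H).ker = H.transpose.mulVecLin.ker := by
  have hflip (x y : Fin (n + 1) → K) :
      sesqForm σ H y x = (H.transpose.mulVec x) ⬝ᵥ (σ ∘ y) := by
    rw [sesqForm_apply, Finset.sum_comm]
    simp [dotProduct, Matrix.mulVec, Finset.sum_mul]
  ext x
  rw [LinearMap.mem_ker, LinearMap.mem_ker, Matrix.mulVecLin_apply, LinearMap.ext_iff]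
  constructor
  · intro h
    funext j
    have hj := (hflip x (Pi.single j 1)).symm.trans (hB.eq_iff.1 (h (Pi.single j 1)))
    have hsingle : σ ∘ Pi.single j 1 = Pi.single j 1 := by
      ext i
      rcases eq_or_ne i j with rfl | h <;> simp [*]
    simpa [hsingle] using hj
  · intro h y
    rw [LinearMap.zero_apply, hB.eq_iff, hflip, h, zero_dotProduct]

theorem exists_ker_sesqForm_eq_span {σ : K →+* K} {H : Matrix (Fin (n + 1)) (Fin (n + 1)) K}
    (hB : (sesqForm σ H).IsSymm) (hrank : H.rank = n) :
    ∃ r ≠ 0, (sesqForm σ H).ker = span K {r} := by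
  have hker : Module.finrank K H.transpose.mulVecLin.ker = 1 := by
    have := H.transpose.mulVecLin.finrank_range_add_finrank_ker
    rw [← Matrix.rank, Matrix.rank_transpose, hrank, Module.finrank_fin_fun] at this
    omega
  rw [ker_sesqForm hB]
  obtain ⟨r, hr, hr0⟩ := exists_mem_ne_zero_of_ne_bot (one_le_finrank_iff.1 hker.ge)
  exact ⟨r, hr0, eq_span_singleton_of_mem_of_finrank_eq_one hker hr hr0⟩

theorem sesqForm_map {L : Type*} [Field L] [Algebra K L] {σ : K →+* K} {τ : L →+* L}
    (hτ : ∀ a, τ (algebraMap K L a) = algebraMap K L (σ a))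
    (H : Matrix (Fin (n + 1)) (Fin (n + 1)) K) (x y : Fin (n + 1) → K) :
    sesqForm τ (H.map (algebraMap K L)) (fun i => algebraMap K L (x i))
      (fun i => algebraMap K L (y i)) = algebraMap K L (sesqForm σ H x y) := by
  simp [sesqForm_apply, hτ]

theorem exists_ringHom_apply_eq_pow [Finite K] (hq : Nat.card K = q ^ 2) (L : Type*) [Field L]
    [Algebra K L] : ∃ σ : L →+* L, ∀ a, σ a = a ^ q := by
  have := Fintype.ofFinite K
  obtain ⟨p, hp⟩ := CharP.exists K
  obtain ⟨m, hprime, hm⟩ := FiniteField.card K p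
  rw [← Nat.card_eq_fintype_card, hq] at hm
  obtain ⟨k, -, rfl⟩ := (Nat.dvd_prime_pow hprime).1 (hm ▸ dvd_pow_self q two_ne_zero)
  have : CharP L p := charP_of_injective_algebraMap (algebraMap K L).injective p
  have : ExpChar L p := ExpChar.prime hprime
  exact ⟨iterateFrobenius L p k, fun a => iterateFrobenius_def p k a⟩

theorem exists_add_pow_ne_zero [Finite K] (hq : Nat.card K = q ^ 2) : ∃ a : K, a + a ^ q ≠ 0 := by
  have hq2 := two_le_of_card_eq_sq hq
  have := Fintype.ofFinite K
  by_contra! h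
  have hdeg : (Polynomial.X ^ q + Polynomial.X : Polynomial K).natDegree = q := by
    rw [Polynomial.natDegree_add_eq_left_of_natDegree_lt] <;> simp; omega
  have hzero : (Polynomial.X ^ q + Polynomial.X : Polynomial K) = 0 := by
    refine Polynomial.eq_zero_of_natDegree_lt_card_of_eval_eq_zero _ Function.injective_id
      (fun a => by simpa [add_comm] using h a) ?_
    rw [hdeg, ← Nat.card_eq_fintype_card, hq]
    nlinarith
  rw [hzero, Polynomial.natDegree_zero] at hdeg
  omega

theorem isHomogeneous_hermitianPoly (H : Matrix (Fin (n + 1)) (Fin (n + 1)) K) :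
    (hermitianPoly q H).IsHomogeneous (1 + q) :=
  MvPolynomial.IsHomogeneous.sum _ _ _ fun i _ => MvPolynomial.IsHomogeneous.sum _ _ _ fun j _ =>
    (MvPolynomial.isHomogeneous_C_mul_X (H i j) i).mul (MvPolynomial.isHomogeneous_X_pow j q)

theorem aeval_hermitianPoly {L : Type*} [Field L] [Algebra K L] {τ : L →+* L}
    (hτ : ∀ a, τ a = a ^ q) (H : Matrix (Fin (n + 1)) (Fin (n + 1)) K) (x : Fin (n + 1) → L) :
    MvPolynomial.aeval x (hermitianPoly q H) = sesqForm τ (H.map (algebraMap K L)) x x := by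
  simp [hermitianPoly, sesqForm_apply, hτ]

theorem mk_mem_zeroLocus_hermitianPoly_iff {σ : K →+* K} (hσ : ∀ a, σ a = a ^ q)
    (H : Matrix (Fin (n + 1)) (Fin (n + 1)) K) {x : Fin (n + 1) → K} (hx : x ≠ 0) :
    Projectivization.mk K x hx ∈ zeroLocus (hermitianPoly q H) K ↔ sesqForm σ H x x = 0 := by
  rw [mk_mem_zeroLocus_iff (isHomogeneous_hermitianPoly H), aeval_hermitianPoly hσ,
    Algebra.algebraMap_self, RingHom.coe_id, Matrix.map_id]

theorem mk_mem_linearPoints_iff (W : Submodule K (Fin (n + 1) → K)) {v : Fin (n + 1) → K}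
    (hv : v ≠ 0) : Projectivization.mk K v hv ∈ linearPoints W K ↔ v ∈ W := by
  obtain ⟨a, ha⟩ := Projectivization.exists_smul_eq_mk_rep K v hv
  rw [mem_linearPoints_self_iff, ← ha]
  exact W.smul_mem_iff a.ne_zero

theorem linearPoints_subset_zeroLocus {L : Type*} [Field L] [Algebra K L] {d : ℕ}
    {F : MvPolynomial (Fin (n + 1)) K} (hF : F.IsHomogeneous d)
    {W : Submodule K (Fin (n + 1) → K)} (hW : linearPoints W L ⊆ zeroLocus F L) :
    linearPoints W K ⊆ zeroLocus F K := by
  intro p hp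
  induction p with | h w hw =>
  rw [mk_mem_linearPoints_iff] at hp
  have hw' : (fun i => algebraMap K L (w i)) ≠ 0 := fun h => hw <| by
    funext i
    exact (map_eq_zero _).1 (congr_fun h i)
  have hmem : Projectivization.mk L _ hw' ∈ linearPoints W L := by
    obtain ⟨a, ha⟩ := Projectivization.exists_smul_eq_mk_rep L _ hw'
    rw [linearPoints, Set.mem_ofPred_eq, ← ha]
    exact smul_mem _ _ (subset_span ⟨w, hp, rfl⟩)
  have hzero := (mk_mem_zeroLocus_iff hF L _ hw').1 (hW hmem)
  rw [mk_mem_zeroLocus_iff hF]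
  refine (map_eq_zero (algebraMap K L)).1 ?_
  rwa [← MvPolynomial.aeval_algebraMap_apply]

theorem sesqForm_eq_zero_of_linearPoints_subset [Finite K] (hq : Nat.card K = q ^ 2) {σ : K →+* K}
    (hσ : ∀ a, σ a = a ^ q) {H : Matrix (Fin (n + 1)) (Fin (n + 1)) K}
    (hB : (sesqForm σ H).IsSymm) {W : Submodule K (Fin (n + 1) → K)}
    (hW : linearPoints W K ⊆ zeroLocus (hermitianPoly q H) K) {x y : Fin (n + 1) → K} (hx : x ∈ W)
    (hy : y ∈ W) : sesqForm σ H x y = 0 := by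
  refine apply_eq_zero_of_isotropic hB (by simpa [hσ] using exists_add_pow_ne_zero hq)
    (fun w hw => ?_) hx hy
  rcases eq_or_ne w 0 with rfl | hw0
  · simp
  · rw [← mk_mem_zeroLocus_hermitianPoly_iff hσ H hw0]
    exact hW ((mk_mem_linearPoints_iff W hw0).2 hw)

theorem isLineOf_hermitianPoly_iff [Finite K] (hq : Nat.card K = q ^ 2) {σ : K →+* K}
    (hσ : ∀ a, σ a = a ^ q) {H : Matrix (Fin (n + 1)) (Fin (n + 1)) K}
    (hB : (sesqForm σ H).IsSymm) {W : Submodule K (Fin (n + 1) → K)} :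
    IsLineOf (hermitianPoly q H) W ↔
      Module.finrank K W = 2 ∧ linearPoints W K ⊆ zeroLocus (hermitianPoly q H) K := by
  let L := AlgebraicClosure K
  obtain ⟨τ, hτ⟩ := exists_ringHom_apply_eq_pow hq L
  have hmap (x y : Fin (n + 1) → K) := sesqForm_map (τ := τ) (σ := σ) (fun a => by
    rw [hτ, hσ, map_pow]) H x y
  refine and_congr_right fun _ =>
    ⟨linearPoints_subset_zeroLocus (isHomogeneous_hermitianPoly H), fun h p hp => ?_⟩
  rw [zeroLocus, Set.mem_ofPred_eq, aeval_hermitianPoly hτ]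
  refine apply_eq_zero_of_mem_span ?_ hp hp
  rintro _ ⟨x, hx, rfl⟩ _ ⟨y, hy, rfl⟩
  rw [hmap, sesqForm_eq_zero_of_linearPoints_subset hq hσ hB h hx hy, map_zero]

end HermitianMatrices

section LinesThroughAPoint

variable {K : Type*} [Field K] {n : ℕ} {r : Fin (n + 1) → K}

theorem ncard_linearPoints [Finite K] {W : Submodule K (Fin (n + 1) → K)}
    (hW : Module.finrank K W = 2) : (linearPoints W K).ncard = Nat.card K + 1 := by
  have hrange : linearPoints W K =
      Set.range (Projectivization.map W.subtype W.injective_subtype) := by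
    ext p
    constructor
    · intro hp
      rw [mem_linearPoints_self_iff] at hp
      exact ⟨Projectivization.mk K ⟨p.rep, hp⟩ fun h => p.rep_nonzero (congr_arg Subtype.val h),
        p.mk_rep⟩
    · rintro ⟨w, rfl⟩
      induction w with | h w hw =>
      exact (mk_mem_linearPoints_iff W _).2 w.2
  rw [hrange, ← Set.image_univ, Set.ncard_image_of_injective _
    (Projectivization.map_injective _ W.injective_subtype), Set.ncard_univ,
    Projectivization.card_of_finrank_two K _ hW]

theorem mk_eq_mk_iff_mem_span_singleton (hr : r ≠ 0) {v : Fin (n + 1) → K} (hv : v ≠ 0) :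
    Projectivization.mk K v hv = Projectivization.mk K r hr ↔ v ∈ span K {r} := by
  rw [Projectivization.mk_eq_mk_iff', mem_span_singleton]

theorem ncard_biUnion_linearPoints [Finite K] (hr : r ≠ 0)
    {S : Finset (Submodule K (Fin (n + 1) → K))} (hS : S.Nonempty)
    (hlines : ∀ W ∈ S, Module.finrank K W = 2 ∧ r ∈ W) :
    (⋃ W ∈ S, linearPoints W K).ncard = 1 + Nat.card K * S.card := by
  set P := Projectivization.mk K r hr
  have hP {W} (hW : W ∈ S) : P ∈ linearPoints W K :=
    (mk_mem_linearPoints_iff W hr).2 (hlines W hW).2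
  have hcard (W) (hW : W ∈ S) : (linearPoints W K \ {P}).ncard = Nat.card K := by
    rw [Set.ncard_sdiff_singleton_of_mem (hP hW), ncard_linearPoints (hlines W hW).1,
      Nat.add_sub_cancel]
  have hdisj : (S : Set (Submodule K (Fin (n + 1) → K))).PairwiseDisjoint
      fun W => linearPoints W K \ {P} := by
    refine fun W hW W' hW' hne => Set.disjoint_left.2 fun p hp hp' => hne ?_
    induction p with | h v hv =>
    have hvr : v ∉ span K {r} := mt (mk_eq_mk_iff_mem_span_singleton hr hv).2 hp.2
    have heq {W} (hW : W ∈ S) (hv' : Projectivization.mk K v hv ∈ linearPoints W K) :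
        span K {r, v} = W :=
      span_pair_eq_of_finrank_eq_two (hlines W hW).1 hr hvr (hlines W hW).2
        ((mk_mem_linearPoints_iff W hv).1 hv')
    exact (heq hW hp.1).symm.trans (heq hW' hp'.1)
  obtain ⟨W₀, hW₀⟩ := hS
  rw [← Set.ncard_sdiff_singleton_add_one (Set.mem_iUnion₂.2 ⟨W₀, hW₀, hP hW₀⟩)]
  simp only [Set.iUnion_sdiff, ← Finset.mem_coe]
  rw [S.finite_toSet.ncard_biUnion (fun W _ => Set.toFinite _) hdisj, finsum_mem_coe_finset,
    Finset.sum_congr rfl hcard, Finset.sum_const, smul_eq_mul]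
  ring

theorem exists_eq_biUnion_linearPoints [Finite K] (hr : r ≠ 0)
    {X : Set (Projectivization K (Fin (n + 1) → K))}
    (hX : ∀ v (hv : v ≠ 0), Projectivization.mk K v hv ∈ X → linearPoints (span K {r, v}) K ⊆ X)
    (hcard : 1 < X.ncard) :
    ∃ S : Finset (Submodule K (Fin (n + 1) → K)), S.Nonempty ∧
      (∀ W ∈ S, Module.finrank K W = 2 ∧ r ∈ W) ∧ X = ⋃ W ∈ S, linearPoints W K := by
  let S := {W : Submodule K (Fin (n + 1) → K) |
    Module.finrank K W = 2 ∧ r ∈ W ∧ linearPoints W K ⊆ X}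
  have hspan {v} (hv : v ≠ 0) (hvr : v ∉ span K {r}) (hvX : Projectivization.mk K v hv ∈ X) :
      span K {r, v} ∈ S :=
    ⟨finrank_span_pair hr hvr, mem_span_of_mem (by simp), hX v hv hvX⟩
  obtain ⟨p, hpX, hpr⟩ := Set.exists_ne_of_one_lt_ncard hcard (Projectivization.mk K r hr)
  induction p with | h w hw =>
  have hwS := hspan hw (mt (mk_eq_mk_iff_mem_span_singleton hr hw).2 hpr) hpX
  refine ⟨S.toFinite.toFinset, ⟨_, S.toFinite.mem_toFinset.2 hwS⟩, fun W hW => ?_,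
    Set.Subset.antisymm (fun p hp => ?_) ?_⟩
  · obtain ⟨hW2, hrW, -⟩ := S.toFinite.mem_toFinset.1 hW
    exact ⟨hW2, hrW⟩
  · induction p with | h v hv =>
    simp only [Set.Finite.mem_toFinset, Set.mem_iUnion₂, exists_prop, mk_mem_linearPoints_iff]
    by_cases hvr : v ∈ span K {r}
    · exact ⟨_, hwS, span_mono (by simp) hvr⟩
    · exact ⟨_, hspan hv hvr hp, mem_span_of_mem (by simp)⟩
  · exact Set.iUnion₂_subset fun W hW => (S.toFinite.mem_toFinset.1 hW).2.2

end LinesThroughAPoint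

section HermitianConesOfRankThree

variable {K : Type*} [Field K] {q d : ℕ}

theorem linearPoints_span_pair_subset {n : ℕ} {σ : K →+* K}
    {H : Matrix (Fin (n + 1)) (Fin (n + 1)) K} (hσ : ∀ a, σ a = a ^ q) (hB : (sesqForm σ H).IsSymm)
    {r : Fin (n + 1) → K} (hker : (sesqForm σ H).ker = span K {r})
    {F : MvPolynomial (Fin (n + 1)) K} (hF : F.IsHomogeneous d)
    (hinv : ∀ x (t : K), MvPolynomial.eval (x + t • r) F = MvPolynomial.eval x F)
    {v : Fin (n + 1) → K} (hv : v ≠ 0) (hvX : Projectivization.mk K v hv ∈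
      zeroLocus (hermitianPoly q H) K ∩ zeroLocus F K) :
    linearPoints (span K {r, v}) K ⊆ zeroLocus (hermitianPoly q H) K ∩ zeroLocus F K := by
  intro p hp
  induction p with | h w hw =>
  obtain ⟨a, b, rfl⟩ := mem_span_pair.1 ((mk_mem_linearPoints_iff _ hw).1 hp)
  rw [Set.mem_inter_iff, mk_mem_zeroLocus_hermitianPoly_iff hσ, mk_mem_zeroLocus_iff hF,
    MvPolynomial.aeval_eq_eval] at hvX ⊢
  have hr : sesqForm σ H r = 0 := LinearMap.mem_ker.1 (hker ▸ mem_span_singleton_self r)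
  have hvr : sesqForm σ H v r = 0 := by rw [hB.eq_iff, hr, LinearMap.zero_apply]
  refine ⟨by simp [hr, hvr, hvX.1], ?_⟩
  rw [add_comm (a • r), hinv, eval_smul_of_isHomogeneous hF, hvX.2, mul_zero]

variable {σ : K →+* K} {H : Matrix (Fin (3 + 1)) (Fin (3 + 1)) K}

theorem preimage_zeroLocus_hermitianPoly (hσ : ∀ a, σ a = a ^ q) {β γ : K}
    (b : Module.Basis (Fin (3 + 1)) K (Fin (3 + 1) → K))
    (hb : ∀ x, sesqForm σ H x x = b.repr x 1 * σ (b.repr x 3) + σ (b.repr x 1) * b.repr x 3 +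
      β * (σ (b.repr x 2) * b.repr x 2) + γ * (σ (b.repr x 3) * b.repr x 3)) :
    Projectivization.map (b.equivFun.symm : (Fin (3 + 1) → K) →ₗ[K] (Fin (3 + 1) → K))
        b.equivFun.symm.injective ⁻¹' zeroLocus (hermitianPoly q H) K =
      coneOver (zeroLocus (hermitianCurve q β γ) K) := by
  ext p
  induction p with | h c hc =>
  have hrepr (i) : b.repr (b.equivFun.symm c) i = c i := congr_fun (b.equivFun.apply_symm_apply c) i
  rw [Set.mem_preimage, Projectivization.map_mk, mk_mem_zeroLocus_hermitianPoly_iff hσ,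
    mk_mem_coneOver_zeroLocus_iff (isHomogeneous_hermitianCurve q β γ) q.succ_ne_zero,
    aeval_hermitianCurve, LinearEquiv.coe_coe, hb]
  simp only [hrepr, hσ, Fin.tail, Algebra.algebraMap_self, RingHom.id_apply, ← pow_succ]
  rfl

theorem eval_add_smul_eq_of_le_ncard [Finite K] (hq : Nat.card K = q ^ 2) (hσ : ∀ a, σ a = a ^ q)
    (hB : (sesqForm σ H).IsSymm) {r : Fin (3 + 1) → K} (hr : r ≠ 0)
    (hker : (sesqForm σ H).ker = span K {r}) (hd : 1 ≤ d) (hdq : d ≤ q)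
    {F : MvPolynomial (Fin (3 + 1)) K} (hF0 : F ≠ 0) (hF : F.IsHomogeneous d)
    (hcard : 1 + q ^ 2 * (d * (q + 1)) ≤
      (zeroLocus (hermitianPoly q H) K ∩ zeroLocus F K).ncard) (x : Fin (3 + 1) → K) (t : K) :
    MvPolynomial.eval (x + t • r) F = MvPolynomial.eval x F := by
  have hq0 : 0 < q := hd.trans hdq
  obtain ⟨p, ⟨hpH, -⟩, hpr⟩ := Set.exists_ne_of_one_lt_ncard
    (lt_of_lt_of_le (Nat.lt_add_of_pos_right (by positivity)) hcard) (Projectivization.mk K r hr)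
  induction p with | h v hv =>
  obtain ⟨b, hbr, -, -, β, γ, hβ, hb⟩ := exists_basis_apply_eq (Module.finrank_fin_fun K) hB hr hker
    ((mk_mem_zeroLocus_hermitianPoly_iff hσ H hv).1 hpH)
    (mt (mk_eq_mk_iff_mem_span_singleton hr hv).2 hpr)
  let φ := b.equivFun.symm
  obtain ⟨F', hF'0, hF', hF'φ⟩ := exists_eval_eq_eval_linearEquiv hF0 hF φ
  rw [← ncard_preimage_projectivization_map φ, Set.preimage_inter,
    preimage_zeroLocus_hermitianPoly hσ b hb,
    preimage_zeroLocus_of_eval_eq hF hF' φ hF'φ] at hcard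
  have hdeg := natDegree_finSuccEquiv_eq_zero_of_le_ncard hq hdq hβ hF'0 hF' hcard
  let c := b.equivFun x
  have hφ (a) : φ (Fin.cons (c 0 + a) (Fin.tail c)) = x + a • r := by
    have hcons : Fin.cons (c 0 + a) (Fin.tail c) = c + a • Pi.single 0 1 := by
      ext i
      refine Fin.cases ?_ (fun j => ?_) i <;> simp [Fin.tail]
    rw [hcons, map_add, map_smul, LinearEquiv.symm_apply_apply, Module.Basis.equivFun_symm_apply]
    simp [hbr]
  rw [← hφ, ← hF'φ, eval_cons_eq_of_natDegree_eq_zero hdeg _ (c 0 + 0), hF'φ, hφ, zero_smul,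
    add_zero]

theorem mem_of_isLineOf_hermitianPoly [Finite K] (hq : Nat.card K = q ^ 2) (hσ : ∀ a, σ a = a ^ q)
    (hB : (sesqForm σ H).IsSymm) {r : Fin (3 + 1) → K} (hr : r ≠ 0)
    (hker : (sesqForm σ H).ker = span K {r}) {W : Submodule K (Fin (3 + 1) → K)}
    (hW : IsLineOf (hermitianPoly q H) W) : r ∈ W := by
  obtain ⟨hW2, hWH⟩ := (isLineOf_hermitianPoly_iff hq hσ hB).1 hW
  exact mem_of_ker_eq_span_of_isotropic (Module.finrank_fin_fun K) hB hr hker hW2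
    fun x hx y hy => sesqForm_eq_zero_of_linearPoints_subset hq hσ hB hWH hx hy

end HermitianConesOfRankThree

end HermitianCone

theorem mainTheorem9 {K : Type*} [Field K] [Finite K] (q : ℕ) (hq : Nat.card K = q ^ 2)
    (H : Matrix (Fin (3 + 1)) (Fin (3 + 1)) K) (hH : HermitianCone.IsHermitianMatrix q H)
    (hrank : H.rank = 3)
    (d : ℕ) (hd : 1 ≤ d) (hdq : d ≤ q)
    (F : MvPolynomial (Fin (3 + 1)) K) (hF0 : F ≠ 0) (hF : F.IsHomogeneous d) :
    (HermitianCone.zeroLocus (HermitianCone.hermitianPoly q H) K ∩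
        HermitianCone.zeroLocus F K).ncard = 1 + q ^ 2 * (d * (q + 1)) ↔
      ∃ S : Finset (Submodule K (Fin (3 + 1) → K)),
        S.card = d * (q + 1) ∧
        (∀ W ∈ S, HermitianCone.IsLineOf (HermitianCone.hermitianPoly q H) W) ∧
        HermitianCone.zeroLocus (HermitianCone.hermitianPoly q H) K ∩
          HermitianCone.zeroLocus F K = ⋃ W ∈ S, HermitianCone.linearPoints W K := by
  open HermitianCone in
  obtain ⟨σ, hσ⟩ := exists_ringHom_apply_eq_pow hq K
  have hB := isSymm_sesqForm_of_isHermitianMatrix hq hσ hH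
  obtain ⟨r, hr, hker⟩ := exists_ker_sesqForm_eq_span hB hrank
  have hq2 : 0 < q ^ 2 := hq ▸ Nat.card_pos
  constructor
  · intro hcard
    have hinv := eval_add_smul_eq_of_le_ncard hq hσ hB hr hker hd hdq hF0 hF hcard.ge
    obtain ⟨S, hS, hlines, hX⟩ := exists_eq_biUnion_linearPoints hr
      (fun v hv => linearPoints_span_pair_subset hσ hB hker hF hinv hv)
      (by rw [hcard]; exact Nat.lt_add_of_pos_right (by positivity))
    rw [hX, ncard_biUnion_linearPoints hr hS hlines, hq] at hcard
    refine ⟨S, Nat.eq_of_mul_eq_mul_left hq2 (Nat.add_left_cancel hcard), fun W hW => ?_, hX⟩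
    exact (isLineOf_hermitianPoly_iff hq hσ hB).2 ⟨(hlines W hW).1,
      (Set.subset_biUnion_of_mem hW).trans (hX.ge.trans Set.inter_subset_left)⟩
  · rintro ⟨S, hS, hlines, hX⟩
    rw [hX, ncard_biUnion_linearPoints hr (Finset.card_pos.1 (by rw [hS]; positivity))
      (fun W hW => ⟨(hlines W hW).1, mem_of_isLineOf_hermitianPoly hq hσ hB hr hker (hlines W hW)⟩),
      hq, hS]
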